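/- Let $1\le k\le d$ be integers and let $1<p<+\infty$. For $K\subset\{1,\dots,d\}$ let $\pi_K$ be the coordinate projection of $\mathbb{R}^d$ that keeps the coordinates with index in $K$ and sets the others to $0$. Given a norm $\|\cdot\|$ on $\mathbb{R}^d$, its dual norm is $y\mapsto\sup\{\langle x,y\rangle : \|x\|\le 1\}$. Let $\|\cdot\|_{p,\star}$ be the dual norm of the $\ell_p$-norm, let $N_k(y)=\max_{|K|\le k}\|\pi_K y\|_{p,\star}$, and let the $(p,k)$-support norm be the dual norm of $N_k$; denote its closed unit ball by $B$. A proper face of $B$ is a nonempty convex subset $F\subsetneq B$ such that, whenever $x,y\in B$ and some point of the open segment between $x$ and $y$ belongs to $F$, then $x$ and $y$ belong to $F$ (a face need not be exposed). Then every proper face $F$ of $B$ is a hypersimplex: there are integers $1\le m\le n$ and a bijective affine map from the affine hull of $\delta_{n,m}$ onto the affine hull of $F$ that sends $\delta_{n,m}$ onto $F$, where $\delta_{n,m}$ is the convex hull of the vertices of the cube $[0,1]^n$ that have exactly $m$ nonzero coordinates. -/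

import Mathlib

open scoped Matrix

noncomputable section

namespace KSupport

/-- The coordinate projection of `ℝ^d` that keeps the coordinates in `K` and sets the others
to zero. -/
def proj {d : ℕ} (K : Finset (Fin d)) (x : Fin d → ℝ) : Fin d → ℝ :=
  fun i => if i ∈ K then x i else 0

/-- The `ℓ_p`-norm on `ℝ^d`, for a real exponent `p`. -/
def lpNorm {d : ℕ} (p : ℝ) (x : Fin d → ℝ) : ℝ :=
  (∑ i, |x i| ^ p) ^ (1 / p)

/-- The norm dual to a norm `N` on `ℝ^d` for the standard scalar product. -/
def dualNorm {d : ℕ} (N : (Fin d → ℝ) → ℝ) (y : Fin d → ℝ) : ℝ :=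
  sSup {r : ℝ | ∃ x : Fin d → ℝ, N x ≤ 1 ∧ r = x ⬝ᵥ y}

/-- The generalized top-`k` dual norm with source norm `N`: the supremum, over the index sets `K`
with at most `k` elements, of the dual norm of the projection on `K`. -/
def topDualNorm {d : ℕ} (N : (Fin d → ℝ) → ℝ) (k : ℕ) (y : Fin d → ℝ) : ℝ :=
  sSup {r : ℝ | ∃ K : Finset (Fin d), K.card ≤ k ∧ r = dualNorm N (proj K y)}

/-- The generalized `k`-support dual norm with source norm `N`: the norm dual to the generalized
top-`k` dual norm. -/
def supportDualNorm {d : ℕ} (N : (Fin d → ℝ) → ℝ) (k : ℕ) : (Fin d → ℝ) → ℝ :=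
  dualNorm (topDualNorm N k)

/-- The closed unit ball of the `(p,k)`-support norm on `ℝ^d`. -/
def supportBall (d : ℕ) (p : ℝ) (k : ℕ) : Set (Fin d → ℝ) :=
  {x | supportDualNorm (lpNorm p) k x ≤ 1}

/-- `F` is a proper face of the convex set `C`: a nonempty convex extreme subset of `C`, different
from `C`. The face is not required to be exposed. -/
structure IsProperFace {d : ℕ} (C F : Set (Fin d → ℝ)) : Prop where
  isExtreme : IsExtreme ℝ C F
  convex : Convex ℝ F
  nonempty : F.Nonempty
  ne : F ≠ C

/-- The hypersimplex `δ_{n,m}`: the convex hull of the vertices of `[0,1]^n` that have exactly `m`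
nonzero coordinates. -/
def stdHypersimplex (n m : ℕ) : Set (Fin n → ℝ) :=
  convexHull ℝ {v | (∀ i, v i = 0 ∨ v i = 1) ∧ {i | v i ≠ 0}.ncard = m}

/-- `P` is a hypersimplex: for some `1 ≤ m ≤ n`, it is the image of `δ_{n,m}` by an affine map
that is injective on the affine hull of `δ_{n,m}` (so that this map is a bijection between the
affine hulls of `δ_{n,m}` and of `P`). -/
def IsHypersimplex {d : ℕ} (P : Set (Fin d → ℝ)) : Prop :=
  ∃ n m : ℕ, 1 ≤ m ∧ m ≤ n ∧ ∃ f : (Fin n → ℝ) →ᵃ[ℝ] (Fin d → ℝ),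
    Set.InjOn f (affineSpan ℝ (stdHypersimplex n m) : Set (Fin n → ℝ)) ∧
      f '' stdHypersimplex n m = P

end KSupport

end

open scoped Matrix

/-! The ball B is the convex hull of the atoms, the vectors of the ℓ_p unit ball with at most k
nonzero coordinates: this is the bipolar theorem (`supportBall_eq_convexHull`). A proper face F
misses the interior of B, so it lies in a hyperplane ⟨·, y⟩ = 1 with y ≤ 1 on all atoms, and F is
contained in the hull of the atoms lying on that hyperplane.

Let q be the exponent conjugate to p. As 1 < p < ∞, equality in Young's inequality determines each
coordinate of such an atom from y. Hence all of them are restrictions π_K u of a single vector u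
(`eq_proj_of_dotProduct_eq_one`), with the |y_i|^q summing to 1 over K. If u has at most k nonzero
coordinates, the only candidate is u itself and F is a point. Otherwise K is always a k-subset of
the support of u, so F lies in the image under w ↦ u * w of the slice of the cube [0,1]^d by ∑ w_i =
k.

That image lies in B, so extremeness of F can be tested inside the slice. There, a face is obtained
by freezing some coordinates at 0 or 1, and the free coordinates span a smaller slice, which is a
hypersimplex (`isHypersimplex_of_isExtreme_mul`). Only extremeness of F is used, so F need not be
exposed. -/

namespace KSupport

/-! ### Hypersimplices as slices of the cube -/

/-- The slice of the cube `[0,1]^n` by the hyperplane where the coordinates sum to `m`. -/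
def cubeSlice (n m : ℕ) : Set (Fin n → ℝ) :=
  {w | (∀ i, 0 ≤ w i ∧ w i ≤ 1) ∧ ∑ i, w i = m}

theorem convex_cubeSlice (n m : ℕ) : Convex ℝ (cubeSlice n m) := by
  rintro x ⟨hx, hxs⟩ y ⟨hy, hys⟩ a b ha hb hab
  refine ⟨fun i => ⟨?_, ?_⟩, ?_⟩
  · have := mul_nonneg ha (hx i).1
    have := mul_nonneg hb (hy i).1
    simp only [Pi.add_apply, Pi.smul_apply, smul_eq_mul]
    linarith
  · have := mul_le_mul_of_nonneg_left (hx i).2 ha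
    have := mul_le_mul_of_nonneg_left (hy i).2 hb
    simp only [Pi.add_apply, Pi.smul_apply, smul_eq_mul]
    linarith
  · simp only [Pi.add_apply, Pi.smul_apply, smul_eq_mul, Finset.sum_add_distrib,
      ← Finset.mul_sum, hxs, hys]
    rw [← add_mul, hab, one_mul]

theorem isCompact_cubeSlice (n m : ℕ) : IsCompact (cubeSlice n m) := by
  have h : cubeSlice n m = (Set.univ.pi fun _ => Set.Icc (0 : ℝ) 1) ∩ {w | ∑ i, w i = m} := by
    ext w
    simp [cubeSlice, Pi.le_def, forall_and]
  rw [h]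
  refine (isCompact_univ_pi fun _ => isCompact_Icc).inter_right ?_
  exact isClosed_eq (by fun_prop) continuous_const

theorem sum_eq_ncard_of_zero_or_one {n : ℕ} {v : Fin n → ℝ} (hv : ∀ i, v i = 0 ∨ v i = 1) :
    ∑ i, v i = ({i | v i ≠ 0}.ncard : ℝ) := by
  classical
  rw [Set.ncard_eq_toFinset_card', Set.toFinset_ofPred, ← Finset.sum_filter_ne_zero,
    Finset.sum_congr rfl (g := fun _ => (1 : ℝ))]
  · simp
  · intro i hi
    exact (hv i).resolve_left (Finset.mem_filter.1 hi).2

/-- Since the coordinates have an integer sum, a fractional coordinate never comes alone. Moving a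
small mass between two of them, in both directions, exhibits the point as a midpoint in the slice.
-/
theorem zero_or_one_of_mem_extremePoints_cubeSlice {n m : ℕ} {w : Fin n → ℝ}
    (hw : w ∈ (cubeSlice n m).extremePoints ℝ) (i : Fin n) : w i = 0 ∨ w i = 1 := by
  classical
  obtain ⟨⟨hb, hs⟩, hext⟩ := hw
  by_contra hi
  have hfrac : ∃ j, j ≠ i ∧ ¬ (w j = 0 ∨ w j = 1) := by
    by_contra hcon
    push Not at hcon
    have hv : ∀ j, Function.update w i 0 j = 0 ∨ Function.update w i 0 j = 1 := by
      intro j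
      by_cases hji : j = i
      · subst hji; simp
      · rw [Function.update_of_ne hji]; exact hcon j hji
    have h1 := sum_eq_ncard_of_zero_or_one hv
    rw [Finset.sum_update_of_mem (Finset.mem_univ i), zero_add] at h1
    rw [Finset.sum_eq_add_sum_sdiff_singleton_of_mem (Finset.mem_univ i) w, h1] at hs
    push Not at hi
    have h0 : 0 < w i := lt_of_le_of_ne (hb i).1 (Ne.symm hi.1)
    have h2 : w i < 1 := lt_of_le_of_ne (hb i).2 hi.2
    set c := {j | Function.update w i 0 j ≠ 0}.ncard
    have h3 : (c : ℝ) < m := by linarith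
    have h4 : (m : ℝ) < (c + 1 : ℕ) := by push_cast; linarith
    have h5 : c < m := by exact_mod_cast h3
    have h6 : m < c + 1 := by exact_mod_cast h4
    omega
  obtain ⟨j, hji, hj⟩ := hfrac
  push Not at hi hj
  have hi0 : 0 < w i := lt_of_le_of_ne (hb i).1 (Ne.symm hi.1)
  have hi1 : w i < 1 := lt_of_le_of_ne (hb i).2 hi.2
  have hj0 : 0 < w j := lt_of_le_of_ne (hb j).1 (Ne.symm hj.1)
  have hj1 : w j < 1 := lt_of_le_of_ne (hb j).2 hj.2
  obtain ⟨ε, hε, h1, h2, h3, h4⟩ :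
      ∃ ε : ℝ, 0 < ε ∧ ε ≤ w i ∧ ε ≤ 1 - w i ∧ ε ≤ w j ∧ ε ≤ 1 - w j :=
    ⟨min (min (w i) (1 - w i)) (min (w j) (1 - w j)),
      lt_min (lt_min hi0 (by linarith)) (lt_min hj0 (by linarith)),
      by simp, by simp, by simp, by simp⟩
  have key : ∀ s : ℝ, |s| ≤ ε → w + (Pi.single i s - Pi.single j s) ∈ cubeSlice n m := by
    intro s hs'
    have hs' := abs_le.1 hs'
    refine ⟨fun l => ?_, ?_⟩
    · simp only [Pi.add_apply, Pi.sub_apply, Pi.single_apply]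
      have := hb l
      split_ifs with h h'
      · exact absurd (h'.symm.trans h) hji
      · subst h; constructor <;> linarith
      · subst l; constructor <;> linarith
      · simpa using this
    · simp [Finset.sum_add_distrib, hs]
  have h5 := hext (key ε (by rw [abs_of_pos hε])) (key (-ε) (by rw [abs_neg, abs_of_pos hε]))
    ⟨1 / 2, 1 / 2, by norm_num, by norm_num, by norm_num, by
      ext l
      simp only [Pi.add_apply, Pi.smul_apply, Pi.sub_apply, Pi.single_apply, smul_eq_mul]
      split_ifs <;> ring⟩
  have h6 := congrFun h5 i
  simp [Ne.symm hji] at h6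
  exact hε.ne' h6

/-- Krein–Milman; the closure it involves disappears because the hull of finitely many vertices is
closed. -/
theorem stdHypersimplex_eq_cubeSlice (n m : ℕ) : stdHypersimplex n m = cubeSlice n m := by
  apply subset_antisymm
  · refine convexHull_min ?_ (convex_cubeSlice n m)
    rintro v ⟨hv, hc⟩
    refine ⟨fun i => ?_, ?_⟩
    · rcases hv i with h | h <;> simp [h]
    · rw [sum_eq_ncard_of_zero_or_one hv, hc]
  · have hfin : {v : Fin n → ℝ | (∀ i, v i = 0 ∨ v i = 1) ∧ {i | v i ≠ 0}.ncard = m}.Finite := by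
      refine (Set.Finite.pi' (t := fun _ : Fin n => ({0, 1} : Set ℝ))
        fun _ => by simp).subset ?_
      rintro v ⟨hv, -⟩
      simpa using hv
    rw [← closure_convexHull_extremePoints (isCompact_cubeSlice n m) (convex_cubeSlice n m)]
    refine closure_minimal (convexHull_mono ?_) (hfin.isClosed_convexHull ℝ)
    intro w hw
    have h := zero_or_one_of_mem_extremePoints_cubeSlice hw
    refine ⟨h, ?_⟩
    have h2 := hw.1.2
    rw [sum_eq_ncard_of_zero_or_one h] at h2
    exact_mod_cast h2

theorem isHypersimplex_singleton {d : ℕ} (u : Fin d → ℝ) : IsHypersimplex {u} := by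
  have h : stdHypersimplex 1 1 = {fun _ => 1} := by
    rw [stdHypersimplex_eq_cubeSlice]
    ext w
    constructor
    · rintro ⟨-, h⟩
      ext i
      fin_cases i
      simpa using h
    · rintro rfl
      simp [cubeSlice]
  refine ⟨1, 1, le_rfl, le_rfl, AffineMap.const ℝ _ u, ?_, ?_⟩
  · rw [h, AffineSubspace.coe_affineSpan_singleton]
    exact Set.injOn_singleton _ _
  · rw [h]; simp

/-! ### Faces of a linear image of a cube slice -/

/-- Let `F` be a nonempty convex subset of the image by `w ↦ u * w` of the part of the slice that
is supported in the support of `u`. If `F` is extreme in a set that contains the image of the whole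
slice, then `F` is a hypersimplex. -/
theorem isHypersimplex_of_isExtreme_mul {d k : ℕ} {u : Fin d → ℝ} {B F : Set (Fin d → ℝ)}
    (hB : ∀ w ∈ cubeSlice d k, u * w ∈ B) (hext : IsExtreme ℝ B F) (hconv : Convex ℝ F)
    (hne : F.Nonempty)
    (hF : ∀ x ∈ F, ∃ w ∈ cubeSlice d k, (∀ i, u i = 0 → w i = 0) ∧ u * w = x) :
    IsHypersimplex F := by
  classical
  set W : Set (Fin d → ℝ) := {w | w ∈ cubeSlice d k ∧ (∀ i, u i = 0 → w i = 0) ∧ u * w ∈ F}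
  have hWne : W.Nonempty := by
    obtain ⟨x, hx⟩ := hne
    obtain ⟨w, hw, hw0, rfl⟩ := hF x hx
    exact ⟨w, hw, hw0, hx⟩
  let frac : (Fin d → ℝ) → Finset (Fin d) := fun w => {i | w i ≠ 0 ∧ w i ≠ 1}
  -- A point with the most fractional coordinates plays the role of a relative interior point of the
  -- face.
  obtain ⟨w, hw, hmax⟩ : ∃ w ∈ W, ∀ v ∈ W, (frac v).card ≤ (frac w).card := by
    have hfin : ((fun w => (frac w).card) '' W).Finite :=
      (Set.finite_Iic d).subset (by
        rintro _ ⟨v, -, rfl⟩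
        exact (Finset.card_le_univ _).trans (by simp))
    obtain ⟨-, ⟨w, hw, rfl⟩, h⟩ := hfin.exists_maximalFor id _ (hWne.image _)
    refine ⟨w, hw, fun v hv => ?_⟩
    by_contra hlt
    exact hlt (h (Set.mem_image_of_mem _ hv) (not_le.1 hlt).le)
  obtain ⟨⟨hwb, hws⟩, hw0, hwF⟩ := hw
  set R := frac w with hR
  have hRmem : ∀ i, i ∈ R ↔ w i ≠ 0 ∧ w i ≠ 1 := by simp [hR, frac]
  have hRpos : ∀ i ∈ R, 0 < w i ∧ w i < 1 := fun i hi =>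
    ⟨lt_of_le_of_ne (hwb i).1 (Ne.symm ((hRmem i).1 hi).1),
      lt_of_le_of_ne (hwb i).2 ((hRmem i).1 hi).2⟩
  -- The midpoint of v and w is fractional on R, hence by maximality nowhere else. A midpoint
  -- coordinate equal to 0 or 1 forces both endpoints to that value.
  have hagree : ∀ v ∈ W, ∀ i ∉ R, v i = w i := by
    rintro v ⟨⟨hvb, hvs⟩, hv0, hvF⟩ i hi
    set t : Fin d → ℝ := (1 / 2 : ℝ) • v + (1 / 2 : ℝ) • w with ht
    have htv : ∀ j, t j = (v j + w j) / 2 := fun j => by simp [ht]; ring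
    have htW : t ∈ W := by
      refine ⟨convex_cubeSlice d k ⟨hvb, hvs⟩ ⟨hwb, hws⟩ (by norm_num) (by norm_num)
        (by norm_num), fun j hj => by rw [htv, hv0 j hj, hw0 j hj]; norm_num, ?_⟩
      have := hconv hvF hwF (a := 1 / 2) (b := 1 / 2) (by norm_num) (by norm_num) (by norm_num)
      rwa [ht, mul_add, mul_smul_comm, mul_smul_comm]
    have hsub : R ⊆ frac t := by
      intro j hj
      have h1 := hRpos j hj
      have h2 := hvb j
      simp only [frac, Finset.mem_filter, Finset.mem_univ, true_and, htv]
      constructor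
      · intro h; linarith
      · intro h; linarith
    have hit : i ∉ frac t := by
      rwa [← Finset.eq_of_subset_of_card_le hsub (hmax t htW)]
    have h1 := hwb i
    have h2 := hvb i
    rw [hRmem] at hi
    simp only [frac, Finset.mem_filter, Finset.mem_univ, true_and, htv] at hit
    by_cases h3 : (v i + w i) / 2 = 0
    · linarith
    · have h4 : (v i + w i) / 2 = 1 := by tauto
      linarith
  -- The segment from v to w can be prolonged a little beyond w inside the slice, as w is fractional
  -- on R; extremeness at u * w then puts u * v in F.
  have hmemW : ∀ v ∈ cubeSlice d k, (∀ i ∉ R, v i = w i) → u * v ∈ F := by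
    rintro v ⟨hvb, hvs⟩ hv
    obtain ⟨ε, hε, hε'⟩ : ∃ ε : ℝ, 0 < ε ∧ ∀ i ∈ R, ε ≤ w i ∧ ε ≤ 1 - w i := by
      rcases R.eq_empty_or_nonempty with h | h
      · exact ⟨1, one_pos, by simp [h]⟩
      · refine ⟨R.inf' h fun i => min (w i) (1 - w i), ?_, fun i hi => ?_⟩
        · rw [Finset.lt_inf'_iff]
          intro i hi
          exact lt_min (hRpos i hi).1 (by linarith [(hRpos i hi).2])
        · exact le_min_iff.1 (Finset.inf'_le (fun i => min (w i) (1 - w i)) hi)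
    set t : Fin d → ℝ := w + ε • (w - v) with ht
    have htS : t ∈ cubeSlice d k := by
      refine ⟨fun i => ?_, ?_⟩
      · simp only [ht, Pi.add_apply, Pi.smul_apply, Pi.sub_apply, smul_eq_mul]
        by_cases hi : i ∈ R
        · have h1 := hε' i hi
          have h2 := hwb i
          have h3 := hvb i
          constructor <;> nlinarith
        · rw [hv i hi, sub_self, mul_zero, add_zero]; exact hwb i
      · simp only [ht, Pi.add_apply, Pi.smul_apply, Pi.sub_apply, smul_eq_mul,
          Finset.sum_add_distrib, ← Finset.mul_sum, Finset.sum_sub_distrib, hws, hvs]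
        ring
    refine hext.left_mem_of_mem_openSegment (hB v ⟨hvb, hvs⟩) (hB t htS) hwF
      ⟨ε / (1 + ε), 1 / (1 + ε), by positivity, by positivity, by field_simp; ring, ?_⟩
    ext i
    simp only [ht, Pi.add_apply, Pi.smul_apply, Pi.sub_apply, Pi.mul_apply, smul_eq_mul]
    field_simp
    ring
  have hu : ∀ i ∈ R, u i ≠ 0 := fun i hi h => ((hRmem i).1 hi).1 (hw0 i h)
  rcases R.eq_empty_or_nonempty with hRe | hRne
  · have : F = {u * w} := by
      refine Set.eq_singleton_iff_unique_mem.2 ⟨hwF, fun x hx => ?_⟩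
      obtain ⟨v, hv, hv0, rfl⟩ := hF x hx
      congr 1
      ext i
      exact hagree v ⟨hv, hv0, hx⟩ i (by simp [hRe])
    rw [this]
    exact isHypersimplex_singleton _
  · set O : Finset (Fin d) := {i | w i = 1} with hO
    have hsplit : ∀ v : Fin d → ℝ, (∀ i ∉ R, v i = w i) →
        ∑ i, v i = ∑ i ∈ R, v i + O.card := by
      intro v hv
      rw [← Finset.sum_add_sum_compl R v]
      congr 1
      rw [Finset.sum_congr rfl (g := fun i => if i ∈ O then (1 : ℝ) else 0)]
      · rw [← Finset.sum_filter]
        rw [Finset.sum_const, nsmul_eq_mul, mul_one]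
        congr 2
        ext i
        simp only [Finset.mem_filter, Finset.mem_compl, hRmem, hO, Finset.mem_univ, true_and]
        tauto
      · intro i hi
        have hi' := Finset.mem_compl.1 hi
        rw [hv i hi']
        rw [hRmem] at hi'
        simp only [hO, Finset.mem_filter, Finset.mem_univ, true_and]
        split_ifs with h
        · exact h
        · tauto
    have hwR : ∑ i ∈ R, w i + O.card = k := by rw [← hsplit w fun _ _ => rfl, hws]
    have hpos : 0 < ∑ i ∈ R, w i := Finset.sum_pos (fun i hi => (hRpos i hi).1) hRne
    have hle : ∑ i ∈ R, w i ≤ R.card := by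
      simpa using Finset.sum_le_card_nsmul R w 1 fun i hi => (hRpos i hi).2.le
    have hOk : O.card < k := by
      have : (O.card : ℝ) < k := by linarith
      exact_mod_cast this
    -- The free coordinates sum to k minus the number of coordinates frozen at 1. This is positive,
    -- hence written m + 1.
    obtain ⟨m, hm⟩ := Nat.exists_eq_add_of_lt hOk
    have hmR : ∑ i ∈ R, w i = (m + 1 : ℕ) := by
      rw [hm] at hwR; push_cast at hwR ⊢; linarith
    have hmn : m + 1 ≤ R.card := by
      rw [hmR] at hle; exact_mod_cast hle
    let e : Fin R.card ≃ R := R.equivFin.symm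
    let f : (Fin R.card → ℝ) →ᵃ[ℝ] (Fin d → ℝ) :=
      { toFun := fun v i => if h : i ∈ R then u i * v (e.symm ⟨i, h⟩) else u i * w i
        linear :=
          { toFun := fun v i => if h : i ∈ R then u i * v (e.symm ⟨i, h⟩) else 0
            map_add' := fun v v' => by
              ext i
              simp only [Pi.add_apply]
              split_ifs <;> ring
            map_smul' := fun c v => by
              ext i
              simp only [Pi.smul_apply, smul_eq_mul, RingHom.id_apply]
              split_ifs <;> ring }
        map_vadd' := fun v v' => by
          ext i
          simp only [vadd_eq_add, Pi.add_apply, LinearMap.coe_mk, AddHom.coe_mk]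
          split_ifs <;> ring }
    have hf : ∀ v i, f v i = if h : i ∈ R then u i * v (e.symm ⟨i, h⟩) else u i * w i :=
      fun _ _ => rfl
    refine ⟨R.card, m + 1, by omega, hmn, f, ?_, ?_⟩
    · refine Function.Injective.injOn fun v v' h => ?_
      ext j
      have h1 := congrFun h (e j)
      rw [hf, hf, dif_pos (e j).2, dif_pos (e j).2] at h1
      simpa using mul_left_cancel₀ (hu _ (e j).2) h1
    · rw [stdHypersimplex_eq_cubeSlice]
      apply subset_antisymm
      · rintro _ ⟨v, ⟨hvb, hvs⟩, rfl⟩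
        set v' : Fin d → ℝ := fun i => if h : i ∈ R then v (e.symm ⟨i, h⟩) else w i with hv'
        have h1 : ∀ i ∉ R, v' i = w i := fun i hi => by simp [hv', hi]
        have h2 : f v = u * v' := by
          ext i
          rw [hf, Pi.mul_apply, hv']
          dsimp only
          split_ifs <;> rfl
        rw [h2]
        refine hmemW v' ⟨fun i => ?_, ?_⟩ h1
        · rw [hv']
          dsimp only
          split_ifs
          · exact hvb _
          · exact hwb i
        · rw [hsplit v' h1, ← hwR, hmR, ← hvs, ← Finset.sum_coe_sort R, ← e.sum_comp]
          congr 1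
          refine Finset.sum_congr rfl fun j _ => ?_
          simp [hv']
      · intro x hx
        obtain ⟨v, hv, hv0, rfl⟩ := hF x hx
        have h1 := hagree v ⟨hv, hv0, hx⟩
        refine ⟨fun j => v (e j), ⟨fun j => hv.1 _, ?_⟩, ?_⟩
        · have h2 := hsplit v h1
          rw [hv.2, ← hwR, hmR] at h2
          rw [e.sum_comp (fun i : R => v i), Finset.sum_coe_sort R]
          linarith
        · ext i
          rw [hf, Pi.mul_apply]
          split_ifs with h
          · simp
          · rw [h1 i h]

/-! ### The support ball as a convex hull -/

/-- The vectors of `ℓ_p`-norm at most one supported in `K`. -/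
def atomsOn {d : ℕ} (p : ℝ) (K : Finset (Fin d)) : Set (Fin d → ℝ) :=
  {a | (∀ i ∉ K, a i = 0) ∧ ∑ i, |a i| ^ p ≤ 1}

/-- The vectors of `ℓ_p`-norm at most one with at most `k` nonzero coordinates. -/
def atoms (d : ℕ) (p : ℝ) (k : ℕ) : Set (Fin d → ℝ) :=
  ⋃ K ∈ (Finset.univ.filter fun K : Finset (Fin d) => K.card ≤ k), atomsOn p K

theorem mem_atoms {d : ℕ} {p : ℝ} {k : ℕ} {a : Fin d → ℝ} :
    a ∈ atoms d p k ↔ ∃ K : Finset (Fin d), K.card ≤ k ∧ a ∈ atomsOn p K := by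
  simp [atoms]

theorem zero_mem_atomsOn {d : ℕ} {p : ℝ} (hp : 1 < p) (K : Finset (Fin d)) :
    (0 : Fin d → ℝ) ∈ atomsOn p K := by
  refine ⟨fun _ _ => rfl, ?_⟩
  simp [Real.zero_rpow (by linarith : p ≠ 0)]

theorem rpow_le_one_iff_of_exponent_pos {x r : ℝ} (hx : 0 ≤ x) (hr : 0 < r) :
    x ^ r ≤ 1 ↔ x ≤ 1 := by
  simpa using Real.rpow_le_rpow_iff hx zero_le_one hr

theorem abs_le_one_of_sum_rpow_le_one {d : ℕ} {p : ℝ} (hp : 1 < p) {a : Fin d → ℝ}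
    (ha : ∑ i, |a i| ^ p ≤ 1) (i : Fin d) : |a i| ≤ 1 := by
  have h1 : |a i| ^ p ≤ 1 :=
    (Finset.single_le_sum (f := fun i => |a i| ^ p)
      (fun j _ => Real.rpow_nonneg (abs_nonneg _) _) (Finset.mem_univ i)).trans ha
  exact (rpow_le_one_iff_of_exponent_pos (abs_nonneg _) (by linarith)).1 h1

theorem lpNorm_le_one_iff {d : ℕ} {p : ℝ} (hp : 1 < p) {x : Fin d → ℝ} :
    lpNorm p x ≤ 1 ↔ ∑ i, |x i| ^ p ≤ 1 := by
  have h0 : 0 ≤ ∑ i, |x i| ^ p :=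
    Finset.sum_nonneg fun i _ => Real.rpow_nonneg (abs_nonneg _) _
  exact rpow_le_one_iff_of_exponent_pos h0 (by positivity)

theorem isCompact_atomsOn {d : ℕ} {p : ℝ} (hp : 1 < p) (K : Finset (Fin d)) :
    IsCompact (atomsOn p K) := by
  have hcl : IsClosed (atomsOn p K) := by
    have : atomsOn p K = (⋂ i ∈ (K : Set (Fin d))ᶜ, {a : Fin d → ℝ | a i = 0}) ∩
        {a | ∑ i, |a i| ^ p ≤ 1} := by
      ext a
      simp [atomsOn]
    rw [this]
    refine (isClosed_biInter fun i _ => isClosed_eq (continuous_apply i) continuous_const).inter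
      (isClosed_le ?_ continuous_const)
    exact continuous_finsetSum _ fun i _ =>
      (continuous_apply i).abs.rpow_const fun _ => Or.inr (by linarith)
  refine (isCompact_univ_pi (s := fun _ : Fin d => Set.Icc (-1 : ℝ) 1)
    fun _ => isCompact_Icc).of_isClosed_subset hcl ?_
  intro a ha i _
  exact abs_le.1 (abs_le_one_of_sum_rpow_le_one hp ha.2 i)

theorem convex_atomsOn {d : ℕ} {p : ℝ} (hp : 1 < p) (K : Finset (Fin d)) :
    Convex ℝ (atomsOn p K) := by
  rintro x ⟨hx0, hx⟩ y ⟨hy0, hy⟩ a b ha hb hab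
  refine ⟨fun i hi => by simp [hx0 i hi, hy0 i hi], ?_⟩
  calc ∑ i, |(a • x + b • y) i| ^ p ≤ ∑ i, (a * |x i| ^ p + b * |y i| ^ p) := by
        refine Finset.sum_le_sum fun i _ => ?_
        have h1 : |(a • x + b • y) i| ≤ a * |x i| + b * |y i| := by
          simp only [Pi.add_apply, Pi.smul_apply, smul_eq_mul]
          refine (abs_add_le _ _).trans ?_
          rw [abs_mul, abs_mul, abs_of_nonneg ha, abs_of_nonneg hb]
        refine (Real.rpow_le_rpow (abs_nonneg _) h1 (by linarith)).trans ?_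
        exact (convexOn_rpow hp.le).2 (abs_nonneg (x i)) (abs_nonneg (y i)) ha hb hab
    _ = a * ∑ i, |x i| ^ p + b * ∑ i, |y i| ^ p := by
        rw [Finset.sum_add_distrib, Finset.mul_sum, Finset.mul_sum]
    _ ≤ a * 1 + b * 1 := by gcongr
    _ = 1 := by rw [mul_one, mul_one, hab]

/-- The convex hull of a finite union of nonempty compact convex sets is compact. -/
theorem isCompact_convexHull_biUnion {E ι : Type*} [NormedAddCommGroup E] [NormedSpace ℝ E]
    {A : ι → Set E} (hc : ∀ i, IsCompact (A i)) (hconv : ∀ i, Convex ℝ (A i))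
    (hne : ∀ i, (A i).Nonempty) (s : Finset ι) : IsCompact (convexHull ℝ (⋃ i ∈ s, A i)) := by
  classical
  induction s using Finset.induction_on with
  | empty => simp
  | insert i s his ih =>
    rw [Finset.set_biUnion_insert]
    rcases s.eq_empty_or_nonempty with rfl | ⟨j, hj⟩
    · simpa [(hconv i).convexHull_eq] using hc i
    · have hU : (⋃ i ∈ s, A i).Nonempty := by
        obtain ⟨x, hx⟩ := hne j
        exact ⟨x, Set.mem_biUnion hj hx⟩
      rw [convexHull_union (hne i) hU, (hconv i).convexHull_eq]
      -- The join of two compact sets is a continuous image of their product with [0,1].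
      have himage : convexJoin ℝ (A i) (convexHull ℝ (⋃ i ∈ s, A i)) =
          (fun q : ℝ × E × E => (1 - q.1) • q.2.1 + q.1 • q.2.2) ''
            (Set.Icc (0 : ℝ) 1 ×ˢ A i ×ˢ convexHull ℝ (⋃ i ∈ s, A i)) := by
        ext x
        simp only [mem_convexJoin, segment_eq_image, Set.mem_image, Set.mem_prod, Prod.exists]
        constructor
        · rintro ⟨a, ha, b, hb, t, ht, rfl⟩
          exact ⟨t, a, b, ⟨ht, ha, hb⟩, rfl⟩
        · rintro ⟨t, a, b, ⟨ht, ha, hb⟩, rfl⟩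
          exact ⟨a, ha, b, hb, t, ht, rfl⟩
      rw [himage]
      exact (isCompact_Icc.prod ((hc i).prod ih)).image (by fun_prop)

theorem isCompact_convexHull_atoms {d : ℕ} {p : ℝ} (hp : 1 < p) (k : ℕ) :
    IsCompact (convexHull ℝ (atoms d p k)) :=
  isCompact_convexHull_biUnion (isCompact_atomsOn hp) (convex_atomsOn hp)
    (fun K => ⟨0, zero_mem_atomsOn hp K⟩) _

theorem dotProduct_le_sum_abs {d : ℕ} {x y : Fin d → ℝ} (hx : ∀ i, |x i| ≤ 1) :
    x ⬝ᵥ y ≤ ∑ i, |y i| := by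
  refine Finset.sum_le_sum fun i _ => (le_abs_self _).trans ?_
  rw [abs_mul]
  exact mul_le_of_le_one_left (abs_nonneg _) (hx i)

theorem proj_mem_atomsOn {d : ℕ} {p : ℝ} (hp : 1 < p) (K : Finset (Fin d)) {x : Fin d → ℝ}
    (hx : ∑ i, |x i| ^ p ≤ 1) : proj K x ∈ atomsOn p K := by
  refine ⟨fun i hi => by simp [proj, hi], le_trans (Finset.sum_le_sum fun i _ => ?_) hx⟩
  unfold proj
  split_ifs
  · exact le_rfl
  · rw [abs_zero, Real.zero_rpow (by linarith)]
    exact Real.rpow_nonneg (abs_nonneg _) _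

theorem dotProduct_proj {d : ℕ} (K : Finset (Fin d)) (x y : Fin d → ℝ) :
    x ⬝ᵥ proj K y = proj K x ⬝ᵥ y :=
  Finset.sum_congr rfl fun i _ => by unfold proj; split_ifs <;> simp

/-- The top-`k` dual norm is the support function of the set of atoms. -/
theorem topDualNorm_le_iff {d k : ℕ} {p : ℝ} (hp : 1 < p) {y : Fin d → ℝ} {c : ℝ} (hc : 0 ≤ c) :
    topDualNorm (lpNorm p) k y ≤ c ↔ ∀ a ∈ atoms d p k, a ⬝ᵥ y ≤ c := by
  constructor
  · intro h a ha
    obtain ⟨K, hK, ha0, ha1⟩ := mem_atoms.1 ha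
    have hfin : {r : ℝ | ∃ K : Finset (Fin d), K.card ≤ k ∧
        r = dualNorm (lpNorm p) (proj K y)}.Finite :=
      (Set.finite_range fun K : Finset (Fin d) => dualNorm (lpNorm p) (proj K y)).subset (by
        rintro _ ⟨K, -, rfl⟩
        exact ⟨K, rfl⟩)
    have h1 : dualNorm (lpNorm p) (proj K y) ≤ c :=
      (le_csSup hfin.bddAbove ⟨K, hK, rfl⟩).trans h
    refine le_trans (b := dualNorm (lpNorm p) (proj K y)) ?_ h1
    refine le_csSup ?_ ⟨a, (lpNorm_le_one_iff hp).2 ha1, ?_⟩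
    · refine ⟨∑ i, |proj K y i|, ?_⟩
      rintro _ ⟨x, hx, rfl⟩
      exact dotProduct_le_sum_abs (abs_le_one_of_sum_rpow_le_one hp ((lpNorm_le_one_iff hp).1 hx))
    · rw [dotProduct_proj]
      congr 1
      ext i
      unfold proj
      split_ifs with h
      · rfl
      · exact ha0 i h
  · intro h
    refine Real.sSup_le ?_ hc
    rintro _ ⟨K, hK, rfl⟩
    refine Real.sSup_le ?_ hc
    rintro _ ⟨x, hx, rfl⟩
    rw [dotProduct_proj]
    exact h _ (mem_atoms.2 ⟨K, hK, proj_mem_atomsOn hp K ((lpNorm_le_one_iff hp).1 hx)⟩)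

theorem single_mem_atoms {d k : ℕ} {p : ℝ} (hp : 1 < p) (hk : 1 ≤ k) (i : Fin d) {s : ℝ}
    (hs : |s| ≤ 1) : Pi.single i s ∈ atoms d p k := by
  refine mem_atoms.2 ⟨{i}, by simpa using hk, fun j hj => ?_, ?_⟩
  · rw [Finset.mem_singleton] at hj
    simp [hj]
  · rw [Finset.sum_eq_single i]
    · simpa using Real.rpow_le_one (abs_nonneg s) hs (by linarith)
    · intro j _ hj
      simp [hj, Real.zero_rpow (by linarith : p ≠ 0)]
    · simp

/-- The signed basis vectors are atoms because 1 ≤ k. This bounds the polar of the atoms, so that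
the `sSup` defining the support norm is a true supremum and not the default value 0. -/
theorem abs_le_one_of_forall_atoms {d k : ℕ} {p : ℝ} (hp : 1 < p) (hk : 1 ≤ k) {y : Fin d → ℝ}
    (hy : ∀ a ∈ atoms d p k, a ⬝ᵥ y ≤ 1) (i : Fin d) : |y i| ≤ 1 := by
  have h1 := hy _ (single_mem_atoms hp hk i (s := 1) (by simp))
  have h2 := hy _ (single_mem_atoms hp hk i (s := -1) (by simp))
  simp at h1 h2
  exact abs_le.2 ⟨by linarith, h1⟩

theorem mem_supportBall_iff {d k : ℕ} {p : ℝ} (hp : 1 < p) (hk : 1 ≤ k) {x : Fin d → ℝ} :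
    x ∈ supportBall d p k ↔
      ∀ y : Fin d → ℝ, (∀ a ∈ atoms d p k, a ⬝ᵥ y ≤ 1) → y ⬝ᵥ x ≤ 1 := by
  constructor
  · intro h y hy
    refine le_trans (b := supportDualNorm (lpNorm p) k x) ?_ h
    refine le_csSup ?_ ⟨y, (topDualNorm_le_iff hp zero_le_one).2 hy, rfl⟩
    refine ⟨∑ i, |x i|, ?_⟩
    rintro _ ⟨z, hz, rfl⟩
    exact dotProduct_le_sum_abs
      (abs_le_one_of_forall_atoms hp hk ((topDualNorm_le_iff hp zero_le_one).1 hz))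
  · intro h
    refine Real.sSup_le ?_ zero_le_one
    rintro _ ⟨y, hy, rfl⟩
    exact h y ((topDualNorm_le_iff hp zero_le_one).1 hy)

theorem exists_dotProduct_eq {d : ℕ} (f : (Fin d → ℝ) →L[ℝ] ℝ) :
    ∃ y : Fin d → ℝ, ∀ x, f x = x ⬝ᵥ y :=
  ⟨fun i => f (Pi.single i 1), fun x => by
    have h := LinearMap.pi_apply_eq_sum_univ (f : (Fin d → ℝ) →ₗ[ℝ] ℝ) x
    simp only [ContinuousLinearMap.coe_coe] at h
    rw [h]
    refine Finset.sum_congr rfl fun i _ => ?_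
    rw [smul_eq_mul]
    congr 2
    ext j
    simp [Pi.single_apply, eq_comm]⟩

theorem supportBall_eq_convexHull {d k : ℕ} {p : ℝ} (hp : 1 < p) (hk : 1 ≤ k) :
    supportBall d p k = convexHull ℝ (atoms d p k) := by
  apply subset_antisymm
  · intro x hx
    by_contra hcon
    obtain ⟨f, s, hfs, hsx⟩ := geometric_hahn_banach_closed_point (convex_convexHull ℝ _)
      (isCompact_convexHull_atoms hp k).isClosed hcon
    obtain ⟨y, hy⟩ := exists_dotProduct_eq f
    -- Zero is an atom, so the separating level is positive and the functional can be rescaled to be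
    -- at most 1 on the atoms.
    have hs : 0 < s := by
      have h0 : (0 : Fin d → ℝ) ∈ atoms d p k :=
        mem_atoms.2 ⟨∅, by simp, zero_mem_atomsOn hp _⟩
      simpa using hfs 0 (subset_convexHull ℝ _ h0)
    have h1 := (mem_supportBall_iff hp hk).1 hx (s⁻¹ • y) fun a ha => by
      rw [dotProduct_smul, ← hy, smul_eq_mul, inv_mul_le_iff₀ hs, mul_one]
      exact (hfs a (subset_convexHull ℝ _ ha)).le
    rw [smul_dotProduct, dotProduct_comm, ← hy, smul_eq_mul, inv_mul_le_iff₀ hs, mul_one] at h1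
    linarith
  · intro x hx
    rw [mem_supportBall_iff hp hk]
    intro y hy
    have hconv : Convex ℝ {z : Fin d → ℝ | z ⬝ᵥ y ≤ 1} :=
      convex_halfSpace_le ⟨fun a b => add_dotProduct a b y, fun c a => smul_dotProduct c a y⟩ 1
    rw [dotProduct_comm]
    exact convexHull_min (fun a ha => hy a ha) hconv hx

theorem zero_mem_interior_supportBall {d k : ℕ} {p : ℝ} (hp : 1 < p) (hk : 1 ≤ k) :
    (0 : Fin d → ℝ) ∈ interior (supportBall d p k) := by
  refine mem_interior.2 ⟨{x | ∑ i, |x i| < 1}, fun x hx => ?_, ?_, by simp⟩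
  · rw [mem_supportBall_iff hp hk]
    intro y hy
    exact (dotProduct_le_sum_abs (abs_le_one_of_forall_atoms hp hk hy)).trans
      (le_of_lt (show ∑ i, |x i| < 1 from hx))
  · exact isOpen_lt (by fun_prop) continuous_const

/-! ### Supporting hyperplanes of proper faces -/

/-- From an interior point x of F, the segment from any z in C to x can be prolonged inside C, so z
lies in F and F would be all of C. -/
theorem IsProperFace.disjoint_interior {d : ℕ} {C F : Set (Fin d → ℝ)} (hF : IsProperFace C F) :
    Disjoint (interior C) F := by
  rw [Set.disjoint_left]
  intro x hx hxF
  refine hF.ne (subset_antisymm hF.isExtreme.subset fun z hz => ?_)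
  have hcont : Continuous fun t : ℝ => x + t • (x - z) := by fun_prop
  have hmem : ∀ᶠ t : ℝ in nhds 0, x + t • (x - z) ∈ C := by
    refine hcont.continuousAt.eventually_mem ?_
    simpa using mem_interior_iff_mem_nhds.1 hx
  obtain ⟨ε, hε, hball⟩ := Metric.eventually_nhds_iff.1 hmem
  have ht : x + (ε / 2) • (x - z) ∈ C := hball (by
    rw [dist_zero_right, Real.norm_eq_abs, abs_of_pos (by positivity)]; linarith)
  refine hF.isExtreme.left_mem_of_mem_openSegment hz ht hxF
    ⟨ε / 2 / (1 + ε / 2), 1 / (1 + ε / 2), by positivity, by positivity, by field_simp; ring, ?_⟩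
  ext i
  simp only [Pi.add_apply, Pi.smul_apply, Pi.sub_apply, smul_eq_mul]
  field_simp
  ring

theorem IsProperFace.exists_dotProduct_eq_one {d k : ℕ} {p : ℝ} (hp : 1 < p) (hk : 1 ≤ k)
    {F : Set (Fin d → ℝ)} (hF : IsProperFace (supportBall d p k) F) :
    ∃ y : Fin d → ℝ, (∀ a ∈ atoms d p k, a ⬝ᵥ y ≤ 1) ∧ ∀ x ∈ F, x ⬝ᵥ y = 1 := by
  have hconv : Convex ℝ (supportBall d p k) := by
    rw [supportBall_eq_convexHull hp hk]; exact convex_convexHull ℝ _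
  have h0 := zero_mem_interior_supportBall (d := d) hp hk
  obtain ⟨f, s, hfs, hsf⟩ := geometric_hahn_banach_open hconv.interior isOpen_interior hF.convex
    hF.disjoint_interior
  have hs : 0 < s := by simpa using hfs 0 h0
  have hle : ∀ x ∈ supportBall d p k, f x ≤ s := by
    intro x hx
    have h1 : x ∈ closure (interior (supportBall d p k)) := by
      rw [hconv.closure_interior_eq_closure_of_nonempty_interior ⟨0, h0⟩]
      exact subset_closure hx
    exact closure_minimal (fun z hz => (hfs z hz).le)
      (isClosed_le f.continuous continuous_const) h1
  obtain ⟨y, hy⟩ := exists_dotProduct_eq f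
  refine ⟨s⁻¹ • y, fun a ha => ?_, fun x hx => ?_⟩
  · rw [dotProduct_smul, ← hy, smul_eq_mul, inv_mul_le_iff₀ hs, mul_one]
    refine hle a ?_
    rw [supportBall_eq_convexHull hp hk]
    exact subset_convexHull ℝ _ ha
  · rw [dotProduct_smul, ← hy, le_antisymm (hle x (hF.isExtreme.subset hx)) (hsf x hx),
      smul_eq_mul, inv_mul_cancel₀ hs.ne']

/-- A point of a convex hull where a functional bounded by `c` attains `c` is in the convex hull
of the points of the set where it attains `c`. -/
theorem mem_convexHull_of_dotProduct_eq {d : ℕ} {C : Set (Fin d → ℝ)} {y x : Fin d → ℝ} {c : ℝ}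
    (hC : ∀ a ∈ C, a ⬝ᵥ y ≤ c) (hx : x ∈ convexHull ℝ C) (hxy : x ⬝ᵥ y = c) :
    x ∈ convexHull ℝ {a ∈ C | a ⬝ᵥ y = c} := by
  set T := convexHull ℝ {a ∈ C | a ⬝ᵥ y = c} with hT
  have hTy : ∀ z ∈ T, z ⬝ᵥ y = c := fun z hz =>
    convexHull_min (fun a ha => ha.2) (convex_hyperplane (f := fun z => z ⬝ᵥ y)
      ⟨fun a b => add_dotProduct a b y, fun c a => smul_dotProduct c a y⟩ c) hz
  -- This set contains C, hence its hull; mixing in a point strictly below level c keeps the result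
  -- strictly below.
  have hconv : Convex ℝ {z | z ⬝ᵥ y < c ∨ z ∈ T} := by
    refine convex_iff_forall_pos.2 fun z hz w hw a b ha hb hab => ?_
    by_cases h : z ∈ T ∧ w ∈ T
    · exact Or.inr (convex_convexHull ℝ _ h.1 h.2 ha.le hb.le hab)
    · left
      have hz' : z ⬝ᵥ y ≤ c := hz.elim le_of_lt fun h => (hTy z h).le
      have hw' : w ⬝ᵥ y ≤ c := hw.elim le_of_lt fun h => (hTy w h).le
      rw [add_dotProduct, smul_dotProduct, smul_dotProduct, smul_eq_mul, smul_eq_mul]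
      have hc : c = a * c + b * c := by rw [← add_mul, hab, one_mul]
      rw [not_and_or] at h
      rcases h with h | h
      · have := mul_lt_mul_of_pos_left (hz.resolve_right h) ha
        have := mul_le_mul_of_nonneg_left hw' hb.le
        linarith
      · have := mul_lt_mul_of_pos_left (hw.resolve_right h) hb
        have := mul_le_mul_of_nonneg_left hz' ha.le
        linarith
  have hmem : x ∈ {z | z ⬝ᵥ y < c ∨ z ∈ T} := by
    refine convexHull_min (fun a ha => ?_) hconv hx
    rcases (hC a ha).lt_or_eq with h | h
    · exact Or.inl h
    · exact Or.inr (subset_convexHull ℝ _ ⟨ha, h⟩)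
  exact hmem.resolve_left (by rw [hxy]; exact lt_irrefl c)

/-! ### Atoms on a supporting hyperplane -/

/-- The unique number for which Young's inequality against `y` is an equality. -/
theorem exists_unique_young_eq {p q : ℝ} (hpq : p.HolderConjugate q) (y : ℝ) :
    ∃ u : ℝ, u * y = |y| ^ q ∧ |u| ^ p = |y| ^ q ∧
      ∀ a : ℝ, a * y = |a| ^ p / p + |y| ^ q / q → a = u := by
  have hp := hpq.pos
  have hq := hpq.symm.pos
  have hq1 : 0 < q - 1 := by linarith [hpq.symm.lt]
  have hpow : (|y| ^ (q - 1)) ^ p = |y| ^ q := by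
    rw [← Real.rpow_mul (abs_nonneg y)]
    congr 1
    have := hpq.symm.sub_one_mul_conj
    linarith
  have hmul : |y| ^ (q - 1) * |y| = |y| ^ q := by
    rcases eq_or_ne y 0 with rfl | hy
    · simp [Real.zero_rpow hq.ne']
    · rw [← Real.rpow_add_one (abs_pos.2 hy).ne']
      congr 1
      ring
  have habs : |(SignType.sign y : ℝ) * |y| ^ (q - 1)| = |y| ^ (q - 1) := by
    rcases eq_or_ne y 0 with rfl | hy
    · simp [Real.zero_rpow hq1.ne']
    · rw [abs_mul, abs_of_nonneg (Real.rpow_nonneg (abs_nonneg y) _)]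
      rcases hy.lt_or_gt with h | h <;> simp [h]
  -- Equality forces |a|^p = |y|^q, that is |a| = |y|^(q-1), and a * y = |a| * |y| fixes the sign.
  refine ⟨SignType.sign y * |y| ^ (q - 1), ?_, by rw [habs, hpow], fun a ha => ?_⟩
  · rw [mul_right_comm, sign_mul_self, mul_comm, hmul]
  · have h1 : a * y ≤ |a| * |y| := by rw [← abs_mul]; exact le_abs_self _
    have h2 := Real.young_inequality_of_nonneg (abs_nonneg a) (abs_nonneg y) hpq
    have h3 : |a| * |y| = |a| ^ p / p + |y| ^ q / q := by linarith
    have h4 := (Real.young_inequality_eq_iff_of_nonneg (abs_nonneg a) (abs_nonneg y) hpq).1 h3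
    have h5 : |a| = |y| ^ (q - 1) := by
      rw [← hpow] at h4
      exact (Real.rpow_left_inj (abs_nonneg a) (Real.rpow_nonneg (abs_nonneg y) _) hp.ne').1 h4
    have h6 : a * y = |a| * |y| := by linarith
    rw [← h5]
    rcases lt_trichotomy y 0 with h | h | h
    · rw [abs_of_neg h, mul_neg, ← neg_mul] at h6
      simpa [h] using mul_right_cancel₀ h.ne h6
    · subst h
      simpa [Real.zero_rpow hq1.ne'] using h5
    · rw [abs_of_pos h] at h6
      simpa [h] using mul_right_cancel₀ h.ne' h6

/-- If `y` is bounded by one on the atoms, the `q`-th powers of its coordinates sum to at most one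
on every index set with at most `k` elements. -/
theorem sum_le_one_of_forall_atoms {d k : ℕ} {p : ℝ} (hp : 1 < p) {y u z : Fin d → ℝ}
    (hy : ∀ a ∈ atoms d p k, a ⬝ᵥ y ≤ 1) (huy : ∀ i, u i * y i = z i)
    (hup : ∀ i, |u i| ^ p = z i) {K : Finset (Fin d)} (hK : K.card ≤ k) :
    ∑ i ∈ K, z i ≤ 1 := by
  by_contra! hcon
  set s := ∑ i ∈ K, z i with hs
  have hs0 : 0 < s := by linarith
  -- This factor gives the restriction of u to K norm 1; its pairing with y is then s^(1 - 1/p),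
  -- which exceeds 1 if s does.
  set c : ℝ := s ^ (-(1 / p)) with hc
  have hc0 : 0 < c := Real.rpow_pos_of_pos hs0 _
  have hcp : c ^ p = s⁻¹ := by
    rw [hc, ← Real.rpow_mul hs0.le, neg_mul, one_div, inv_mul_cancel₀ (by linarith),
      Real.rpow_neg_one]
  have hmem : c • proj K u ∈ atoms d p k := by
    refine mem_atoms.2 ⟨K, hK, fun i hi => by simp [proj, hi], ?_⟩
    have h1 : ∀ i, |(c • proj K u) i| ^ p = if i ∈ K then s⁻¹ * z i else 0 := by
      intro i
      simp only [Pi.smul_apply, proj, smul_eq_mul]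
      split_ifs
      · rw [abs_mul, Real.mul_rpow (abs_nonneg _) (abs_nonneg _), abs_of_pos hc0, hcp, hup]
      · simp [Real.zero_rpow (by linarith : p ≠ 0)]
    rw [Finset.sum_congr rfl fun i _ => h1 i, Finset.sum_ite_mem, Finset.univ_inter,
      ← Finset.mul_sum, ← hs, inv_mul_cancel₀ hs0.ne']
  have h2 := hy _ hmem
  have h3 : proj K u ⬝ᵥ y = s := by
    simp only [dotProduct, proj, ite_mul, zero_mul, huy]
    rw [Finset.sum_ite_mem, Finset.univ_inter]
  rw [smul_dotProduct, h3, smul_eq_mul, hc, ← Real.rpow_add_one hs0.ne'] at h2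
  have h4 : 0 < -(1 / p) + 1 := by
    have : 1 / p < 1 := by rw [div_lt_one (by linarith)]; exact hp
    linarith
  exact absurd h2 (not_le.2 (Real.one_lt_rpow hcon h4))

/-- An atom supported in `K` on which `y` takes the value one is the restriction to `K` of the
vector of equality in Young's inequality. -/
theorem eq_proj_of_dotProduct_eq_one {d : ℕ} {p q : ℝ} (hpq : p.HolderConjugate q)
    {y u a : Fin d → ℝ} {K : Finset (Fin d)}
    (hu : ∀ i, ∀ t : ℝ, t * y i = |t| ^ p / p + |y i| ^ q / q → t = u i)
    (hK : ∑ i ∈ K, |y i| ^ q ≤ 1) (ha : a ∈ atomsOn p K) (hay : a ⬝ᵥ y = 1) :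
    a = proj K u ∧ ∑ i ∈ K, |y i| ^ q = 1 := by
  obtain ⟨ha0, ha1⟩ := ha
  have hp := hpq.pos
  have hq := hpq.symm.pos
  have hinv := hpq.inv_add_inv_eq_one
  have hle : ∀ i ∈ K, a i * y i ≤ |a i| ^ p / p + |y i| ^ q / q :=
    fun i _ => Real.young_inequality _ _ hpq
  have hsum : ∑ i ∈ K, a i * y i = 1 := by
    rw [← hay, dotProduct]
    exact Finset.sum_subset (Finset.subset_univ _) fun i _ hi => by simp [ha0 i hi]
  have haK : ∑ i ∈ K, |a i| ^ p ≤ 1 :=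
    (Finset.sum_le_univ_sum_of_nonneg fun i => Real.rpow_nonneg (abs_nonneg _) _).trans ha1
  have hright : ∑ i ∈ K, (|a i| ^ p / p + |y i| ^ q / q) =
      p⁻¹ * ∑ i ∈ K, |a i| ^ p + q⁻¹ * ∑ i ∈ K, |y i| ^ q := by
    rw [Finset.sum_add_distrib, Finset.mul_sum, Finset.mul_sum]
    congr 1 <;> exact Finset.sum_congr rfl fun i _ => by rw [div_eq_inv_mul]
  have h1 := Finset.sum_le_sum hle
  have h2 := mul_le_mul_of_nonneg_left haK (inv_pos.2 hp).le
  have h3 := mul_le_mul_of_nonneg_left hK (inv_pos.2 hq).le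
  -- Summing Young's inequality over K gives 1 ≤ 1/p + 1/q = 1, so every term is an equality.
  have heq := (Finset.sum_eq_sum_iff_of_le hle).1 (by linarith)
  refine ⟨?_, ?_⟩
  · ext i
    unfold proj
    split_ifs with h
    · exact hu i _ (heq i h)
    · exact ha0 i h
  · refine mul_left_cancel₀ (inv_pos.2 hq).ne' ?_
    linarith

theorem proj_eq_mul_indicator {d : ℕ} (K : Finset (Fin d)) (u : Fin d → ℝ) :
    proj K u = u * proj K 1 := by
  ext i
  simp [proj]

/-- The slice is the hull of the indicators of k-sets, and u times such an indicator is an atom. -/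
theorem mul_mem_supportBall {d k : ℕ} {p : ℝ} (hp : 1 < p) (hk : 1 ≤ k) {u : Fin d → ℝ}
    (hu : ∀ K : Finset (Fin d), K.card ≤ k → ∑ i ∈ K, |u i| ^ p ≤ 1) {w : Fin d → ℝ}
    (hw : w ∈ cubeSlice d k) : u * w ∈ supportBall d p k := by
  classical
  rw [← stdHypersimplex_eq_cubeSlice] at hw
  rw [supportBall_eq_convexHull hp hk]
  have h1 : LinearMap.mulLeft ℝ u w ∈ LinearMap.mulLeft ℝ u '' stdHypersimplex d k :=
    Set.mem_image_of_mem _ hw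
  rw [stdHypersimplex, LinearMap.image_convexHull] at h1
  refine convexHull_mono ?_ h1
  rintro _ ⟨v, ⟨hv, hc⟩, rfl⟩
  set K : Finset (Fin d) := {i | v i ≠ 0} with hKdef
  have hK : K.card ≤ k := by
    rw [← hc, Set.ncard_eq_toFinset_card', Set.toFinset_ofPred]
  refine mem_atoms.2 ⟨K, hK, fun i hi => ?_, ?_⟩
  · have : v i = 0 := by simpa [hKdef] using hi
    simp [this]
  · refine le_trans (le_of_eq ?_) (hu K hK)
    rw [← Finset.sum_subset (Finset.subset_univ K)]
    · refine Finset.sum_congr rfl fun i hi => ?_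
      have : v i = 1 := (hv i).resolve_left (by simpa [hKdef] using hi)
      simp [this]
    · intro i _ hi
      have : v i = 0 := by simpa [hKdef] using hi
      simp [this, Real.zero_rpow (by linarith : p ≠ 0)]

end KSupport

/-! ### Locating a proper face in a scaled cube slice -/

open KSupport in
theorem mainTheorem9 (d k : ℕ) (hk : 1 ≤ k) (hkd : k ≤ d) (p : ℝ) (hp : 1 < p)
    (F : Set (Fin d → ℝ)) (hF : KSupport.IsProperFace (KSupport.supportBall d p k) F) :
    KSupport.IsHypersimplex F := by
  classical
  obtain ⟨y, hy, hFy⟩ := hF.exists_dotProduct_eq_one hp hk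
  have hpq := Real.HolderConjugate.conjExponent hp
  set q := p.conjExponent
  choose u huy hup hu using fun i => exists_unique_young_eq hpq (y i)
  have hsum : ∀ K : Finset (Fin d), K.card ≤ k → ∑ i ∈ K, |y i| ^ q ≤ 1 :=
    fun K hK => sum_le_one_of_forall_atoms hp hy huy hup hK
  have htight : ∀ x ∈ F, x ∈ convexHull ℝ {a ∈ atoms d p k | a ⬝ᵥ y = 1} := by
    intro x hx
    have h1 := hF.isExtreme.subset hx
    rw [supportBall_eq_convexHull hp hk] at h1
    exact mem_convexHull_of_dotProduct_eq hy h1 (hFy x hx)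
  have hu0 : ∀ i, u i = 0 ↔ |y i| ^ q = 0 := fun i => by
    rw [← hup i, Real.rpow_eq_zero (abs_nonneg _) (by linarith), abs_eq_zero]
  have hz0 : ∀ i, 0 ≤ |y i| ^ q := fun i => Real.rpow_nonneg (abs_nonneg _) _
  set S : Finset (Fin d) := {i | u i ≠ 0} with hS
  have hmemS : ∀ i, i ∈ S ↔ u i ≠ 0 := by simp [hS]
  have hatom : ∀ a ∈ {a ∈ atoms d p k | a ⬝ᵥ y = 1}, ∃ K : Finset (Fin d),
      K ⊆ S ∧ K.card ≤ k ∧ a = proj K u ∧ ∑ i ∈ K, |y i| ^ q = 1 := by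
    rintro a ⟨ha, hay⟩
    obtain ⟨K, hK, haK⟩ := mem_atoms.1 ha
    obtain ⟨h1, h2⟩ := eq_proj_of_dotProduct_eq_one hpq hu (hsum K hK) haK hay
    -- Indices where u vanishes change neither the restriction of u nor the sum.
    refine ⟨K ∩ S, Finset.inter_subset_right,
      (Finset.card_le_card Finset.inter_subset_left).trans hK, ?_, ?_⟩
    · rw [h1]
      ext i
      simp only [proj, Finset.mem_inter, hmemS]
      split_ifs <;> tauto
    · rw [← h2]
      refine Finset.sum_subset Finset.inter_subset_left fun i hi hi' => ?_
      rw [← hu0]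
      by_contra h
      exact hi' (Finset.mem_inter.2 ⟨hi, (hmemS i).2 h⟩)
  -- A set with fewer than k elements that misses some j in S could absorb j, which would push the
  -- sum above 1.
  have hfull : ∀ K : Finset (Fin d), K ⊆ S → K.card < k → ∑ i ∈ K, |y i| ^ q = 1 → K = S := by
    intro K hKS hK hK1
    by_contra hne
    obtain ⟨j, hjS, hjK⟩ := Finset.exists_of_ssubset (hKS.ssubset_of_ne hne)
    have h1 := hsum (insert j K) (by rw [Finset.card_insert_of_notMem hjK]; omega)
    rw [Finset.sum_insert hjK, hK1] at h1
    have h2 : |y j| ^ q ≠ 0 := fun h => (hmemS j).1 hjS ((hu0 j).2 h)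
    exact h2 (le_antisymm (by linarith) (hz0 j))
  by_cases hcard : S.card ≤ k
  · have hFu : ∀ x ∈ F, x = u := by
      intro x hx
      have hsub : {a ∈ atoms d p k | a ⬝ᵥ y = 1} ⊆ {u} := by
        intro a ha
        obtain ⟨K, hKS, hKk, rfl, hK1⟩ := hatom a ha
        have hKeq : K = S := by
          rcases hKk.lt_or_eq with h | h
          · exact hfull K hKS h hK1
          · exact Finset.eq_of_subset_of_card_le hKS (by omega)
        subst hKeq
        ext i
        simp only [proj, hmemS]
        split_ifs <;> tauto
      simpa using convexHull_mono hsub (htight x hx)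
    obtain ⟨x, hx⟩ := hF.nonempty
    have : F = {u} := Set.eq_singleton_iff_unique_mem.2 ⟨hFu x hx ▸ hx, hFu⟩
    rw [this]
    exact isHypersimplex_singleton u
  · refine isHypersimplex_of_isExtreme_mul (u := u)
      (fun w hw => mul_mem_supportBall hp hk (fun K hK => ?_) hw) hF.isExtreme hF.convex
      hF.nonempty fun x hx => ?_
    · simpa only [hup] using hsum K hK
    · have hsub : {a ∈ atoms d p k | a ⬝ᵥ y = 1} ⊆
          LinearMap.mulLeft ℝ u '' {w | w ∈ cubeSlice d k ∧ ∀ i, u i = 0 → w i = 0} := by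
        intro a ha
        obtain ⟨K, hKS, hKk, rfl, hK1⟩ := hatom a ha
        have hKk' : K.card = k := by
          by_contra h
          have := hfull K hKS (by omega) hK1
          subst this
          omega
        refine ⟨proj K 1, ⟨⟨fun i => ?_, ?_⟩, fun i hi => ?_⟩, (proj_eq_mul_indicator K u).symm⟩
        · unfold proj
          split_ifs <;> simp
        · simp [proj, hKk']
        · have : i ∉ K := fun h => (hmemS i).1 (hKS h) hi
          simp [proj, this]
      have hconv : Convex ℝ {w | w ∈ cubeSlice d k ∧ ∀ i, u i = 0 → w i = 0} := by
        rintro v ⟨hv, hv0⟩ w ⟨hw, hw0⟩ a b ha hb hab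
        exact ⟨convex_cubeSlice d k hv hw ha hb hab, fun i hi => by simp [hv0 i hi, hw0 i hi]⟩
      obtain ⟨w, ⟨hw, hw0⟩, hwx⟩ :=
        convexHull_min hsub (hconv.linear_image (LinearMap.mulLeft ℝ u)) (htight x hx)
      exact ⟨w, hw, hw0, hwx⟩
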